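/- There is a polynomial $P(X,Y)$ with real coefficients (independent of all the parameters below) such that for every prime $p$, every integer $s\ge 0$ and every real $\varepsilon>0$ there is a number $q\le P\big((p^2s)^p,\,1/\varepsilon\big)$ with the following property; in particular, for a fixed prime $p$, $q$ is bounded by a polynomial in $s$ and $1/\varepsilon$. For every $n\ge 0$ there is a randomized non-adaptive $q$-query algorithm (it first draws a random seed, which alone determines the $q$ query points $x_1,\dots,x_q\in\mathbb{Z}_p^n$, and then accepts or rejects depending only on the seed and on the values $f(x_1),\dots,f(x_q)$) such that for every $f:\mathbb{Z}_p^n\to\{-1,+1\}$: 1. if $f$ is $s$-sparse, the algorithm accepts with probability at least $2/3$; 2. if $f$ is $\varepsilon$-far from $s$-sparse-Boolean, the algorithm rejects with probability at least $2/3$. Here $f:\mathbb{Z}_p^n\to\{-1,+1\}$ is $s$-sparse if at most $s$ of its Fourier coefficients $\widehat f(r)=p^{-n}\sum_{x\in\mathbb{Z}_p^n}f(x)\,e^{-2\pi i\,(r\cdot x)/p}$, $r\in\mathbb{Z}_p^n$, are non-zero. It is $\varepsilon$-far from $s$-sparse-Boolean if every $s$-sparse $g:\mathbb{Z}_p^n\to\{-1,+1\}$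 satisfies $\big(p^{-n}\sum_{x}|f(x)-g(x)|^2\big)^{1/2}\ge\sqrt{\varepsilon}$. -/

import Mathlib

open scoped ENNReal ComplexConjugate

noncomputable section

namespace SparsityTest

/-- The group `ℤ_p^n`. -/
abbrev Zpn (p n : ℕ) : Type := Fin n → ZMod p

/-- A `{-1,+1}`-valued function, viewed as a complex-valued one (`ℤˣ = {1, -1}`). -/
def toComplex {X : Type} (f : X → ℤˣ) : X → ℂ := fun x => ((f x : ℤ) : ℂ)

variable {p n : ℕ} [Fact p.Prime]

/-- The character `χ_r(x) = ω_p ^ (r · x)` of `ℤ_p^n`, where `ω_p = exp (2πi / p)`.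
Every character of `ℤ_p^n` is `χ_r` for exactly one `r ∈ ℤ_p^n`. -/
def character (r x : Zpn p n) : ℂ := ZMod.stdAddChar (r ⬝ᵥ x)

/-- The Fourier coefficient `p^{-n} ∑_x f(x) * conj (χ_r(x))`. -/
def fourierCoeff (f : Zpn p n → ℂ) (r : Zpn p n) : ℂ :=
  (∑ x : Zpn p n, f x * conj (character r x)) / (p : ℂ) ^ n

/-- The Fourier support (a subset of a finite set), the index `r` standing for `χ_r`. -/
def fourierSupport (f : Zpn p n → ℂ) : Set (Zpn p n) := {r | fourierCoeff f r ≠ 0}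

/-- The number of non-zero Fourier coefficients. -/
def fourierSparsity (f : Zpn p n → ℂ) : ℕ := (fourierSupport f).ncard

/-- The Boolean-valued function `f` has at most `s` non-zero Fourier coefficients. -/
def IsSparse (s : ℕ) (f : Zpn p n → ℤˣ) : Prop := fourierSparsity (toComplex f) ≤ s

/-- The `ℓ₂`-distance with respect to the uniform probability measure on `ℤ_p^n`. -/
def l2Dist (f g : Zpn p n → ℂ) : ℝ :=
  √((∑ x : Zpn p n, ‖f x - g x‖ ^ 2) / (p : ℝ) ^ n)

/-- `f` is at `ℓ₂`-distance at least `√ε` from every `s`-sparse Boolean-valued function. -/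
def IsFarFromSparse (s : ℕ) (ε : ℝ) (f : Zpn p n → ℤˣ) : Prop :=
  ∀ g : Zpn p n → ℤˣ, IsSparse s g → √ε ≤ l2Dist (toComplex f) (toComplex g)

end SparsityTest

/-- A randomized non-adaptive algorithm making `q` queries to an unknown function
`f : X → {-1,+1}`: it draws a random seed, which alone determines all `q` query points, and
then accepts (`true`) or rejects (`false`) depending on the seed and on the `q` answers. -/
structure NonadaptiveTester (X : Type) (q : ℕ) where
  Seed : Type
  law : PMF Seed
  query : Seed → Fin q → X
  verdict : Seed → (Fin q → ℤˣ) → Bool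

namespace NonadaptiveTester

variable {X : Type} {q : ℕ}

/-- The output of the algorithm on the function `f` when the seed is `ω`. -/
def run (T : NonadaptiveTester X q) (f : X → ℤˣ) (ω : T.Seed) : Bool :=
  T.verdict ω fun i => f (T.query ω i)

/-- The probability that the algorithm outputs `b` on the function `f`. -/
def probOutput (T : NonadaptiveTester X q) (f : X → ℤˣ) (b : Bool) : ℝ≥0∞ :=
  T.law.toOuterMeasure {ω | T.run f ω = b}

end NonadaptiveTester

namespace SparsityTest

/-- `T` tests, with confidence `2/3`, whether a function is `s`-sparse or `ε`-far from
`s`-sparse-Boolean. -/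
def TestsSparsity {p n q : ℕ} [Fact p.Prime] (s : ℕ) (ε : ℝ)
    (T : NonadaptiveTester (Zpn p n) q) : Prop :=
  ∀ f : Zpn p n → ℤˣ,
    (IsSparse s f → 2 / 3 ≤ T.probOutput f true) ∧
    (IsFarFromSparse s ε f → 2 / 3 ≤ T.probOutput f false)

end SparsityTest

end

/-!
Sparsity is tested by restricting `f` along a random linear map `M : ℤ_p^k → ℤ_p^n`, querying `f`
on all `p ^ k` points of the image, and accepting if and only if `f ∘ M` is `s`-sparse. The Fourier
coefficient of `f ∘ M` at `u` is the sum of the coefficients of `f` over the fibre `r M = u`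
(`fourierCoeff_comp_mulVec`), so a sparse `f` is always accepted.

For soundness, let `L` be the set of the frequencies at which the coefficient of `f` is at least a
small threshold `θ`; by Parseval `|L| ≤ θ⁻²`. When `p ^ k` is a large enough polynomial in `p`,
`1 / θ` and `1 / ρ`, two things hold for most `M`.

* The map `r ↦ r M` is injective on `(L + L) ∪ {0}`, by a union bound
  (`pow_mul_card_not_injOn_vecMul_le`).
* The frequencies outside `L` contribute at most `ρ` to each coefficient of `f ∘ M`. The sum of the
  fourth powers of the Fourier coefficients is an average over parallelograms, and `M` maps most
  parallelograms of `ℤ_p^k` to uniformly random ones, so on average over `M` this sum hardly exceeds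
  the corresponding sum for the coefficients of `f` outside `L`, which is at most `θ²`
  (`sum_sum_norm_pow_four_fourierCoeff_comp_le`).

If such an `f ∘ M` is `s`-sparse, its non-zero coefficients are at least `(p s)^{-(p-1)}` in absolute
value (`one_le_pow_mul_norm_fourierCoeff`): after folding to a space of at most `p s` points that
keeps one frequency isolated, the coefficient times the number of points is a non-zero element of
`ℤ[ω]`, whose norm is at least `1` while its conjugates are at most `p s`. With `ρ` below this bound, the support of the transform of
`f ∘ M` is contained in the image of `L`. So `f ∘ M = ∑ c_r χ_{r M}` over `r ∈ L`, and injectivity on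
`(L + L) ∪ {0}` transports the equation `(f ∘ M)² = 1` to `g² = 1` for `g = ∑ c_r χ_r`. Thus `g` is
Boolean-valued and `s`-sparse, and since `|c_r - f̂(r)| ≤ ρ` it satisfies `‖f - g‖² ≤ 2 s ρ`
(`exists_isSparse_close`). For `2 s ρ < ε` this contradicts `f` being `ε`-far.
-/

open scoped ENNReal ComplexConjugate

namespace SparsityTest

variable {p n k : ℕ} [Fact p.Prime]

/-! ### Fourier analysis on `ℤ_p^n` -/

theorem character_add_right (r x y : Zpn p n) :
    character r (x + y) = character r x * character r y := by
  simp [character, dotProduct_add, AddChar.map_add_eq_mul]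

theorem character_add_left (r r' x : Zpn p n) :
    character (r + r') x = character r x * character r' x := by
  simp [character, add_dotProduct, AddChar.map_add_eq_mul]

theorem character_zero_left (x : Zpn p n) : character 0 x = 1 := by
  simp [character]

theorem norm_character (r x : Zpn p n) : ‖character r x‖ = 1 := by
  simp [character]

theorem conj_character (r x : Zpn p n) : conj (character r x) = character (-r) x := by
  simp only [character, neg_dotProduct, AddChar.map_neg_eq_conj]

theorem character_comm (r x : Zpn p n) : character r x = character x r := by
  simp [character, dotProduct_comm]

theorem character_mulVec (M : Matrix (Fin n) (Fin k) (ZMod p)) (r : Zpn p n) (y : Zpn p k) :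
    character r (M.mulVec y) = character (Matrix.vecMul r M) y := by
  simp [character, Matrix.dotProduct_mulVec]

theorem sum_character (r : Zpn p n) :
    ∑ x : Zpn p n, character r x = if r = 0 then (p : ℂ) ^ n else 0 := by
  let ψ : AddChar (Zpn p n) ℂ :=
    { toFun := character r
      map_zero_eq_one' := by simp [character]
      map_add_eq_mul' := character_add_right r }
  have h := AddChar.sum_eq_ite ψ
  have hψ : ψ = 0 ↔ r = 0 := by
    constructor
    · intro h0
      funext i
      have h1 : ψ (Pi.single i 1) = 1 := by rw [h0]; rfl
      have h2 : (ZMod.stdAddChar (r i) : ℂ) = ZMod.stdAddChar (0 : ZMod p) := by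
        simpa [ψ, character] using h1
      exact ZMod.injective_stdAddChar h2
    · rintro rfl
      ext x
      simp [ψ, character]
  simp only [hψ] at h
  simpa [ψ] using h

theorem fourierCoeff_character (v u : Zpn p n) :
    fourierCoeff (character v) u = if v = u then 1 else 0 := by
  have hp : ((p : ℂ) ^ n) ≠ 0 := by
    have := (Fact.out : p.Prime).ne_zero
    positivity
  simp only [fourierCoeff, conj_character, ← character_add_left, sum_character,
    ← sub_eq_add_neg, sub_eq_zero]
  split_ifs <;> simp [hp]

theorem fourierCoeff_sum {ι : Type*} (S : Finset ι) (F : ι → Zpn p n → ℂ) (u : Zpn p n) :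
    fourierCoeff (fun x => ∑ i ∈ S, F i x) u = ∑ i ∈ S, fourierCoeff (F i) u := by
  simp only [fourierCoeff, Finset.sum_mul, ← Finset.sum_div]
  rw [Finset.sum_comm]

theorem fourierCoeff_const_mul (c : ℂ) (F : Zpn p n → ℂ) (u : Zpn p n) :
    fourierCoeff (fun x => c * F x) u = c * fourierCoeff F u := by
  simp only [fourierCoeff, mul_assoc, ← Finset.mul_sum, mul_div_assoc]

theorem fourierCoeff_sum_character {ι : Type*} (S : Finset ι) (c : ι → ℂ) (v : ι → Zpn p n)
    (u : Zpn p n) :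
    fourierCoeff (fun x => ∑ i ∈ S, c i * character (v i) x) u =
      ∑ i ∈ S, if v i = u then c i else 0 := by
  rw [fourierCoeff_sum]
  refine Finset.sum_congr rfl fun i _ => ?_
  rw [fourierCoeff_const_mul, fourierCoeff_character]
  split_ifs <;> simp

/-- Fourier inversion. -/
theorem sum_fourierCoeff_mul_character (f : Zpn p n → ℂ) (x : Zpn p n) :
    ∑ r, fourierCoeff f r * character r x = f x := by
  have hp : ((p : ℂ) ^ n) ≠ 0 := by
    have := (Fact.out : p.Prime).ne_zero
    positivity
  have h : ∀ r, fourierCoeff f r * character r x =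
      ∑ y, f y / (p : ℂ) ^ n * character (x - y) r := by
    intro r
    simp only [fourierCoeff, Finset.sum_div, Finset.sum_mul]
    refine Finset.sum_congr rfl fun y _ => ?_
    rw [conj_character, character_comm (x - y), sub_eq_add_neg, character_add_right,
      ← conj_character, character_comm r (-y), ← conj_character, character_comm y]
    ring
  simp only [h]
  rw [Finset.sum_comm]
  simp only [← Finset.mul_sum, sum_character, sub_eq_zero]
  simp [hp]

/-- Restricting a function along a linear map adds up the Fourier coefficients over the fibres
of the transposed map. -/
theorem fourierCoeff_comp_mulVec (h : Zpn p n → ℂ) (M : Matrix (Fin n) (Fin k) (ZMod p))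
    (u : Zpn p k) :
    fourierCoeff (fun y => h (M.mulVec y)) u =
      ∑ r, if Matrix.vecMul r M = u then fourierCoeff h r else 0 := by
  have h1 : (fun y => h (M.mulVec y)) =
      fun y => ∑ r, fourierCoeff h r * character (Matrix.vecMul r M) y := by
    funext y
    rw [← sum_fourierCoeff_mul_character h (M.mulVec y)]
    simp only [character_mulVec]
  rw [h1, fourierCoeff_sum_character]

/-- Pairing `f` with a combination of characters, in physical and in frequency space. -/
theorem sum_mul_conj_sum_character (f : Zpn p n → ℂ) (S : Finset (Zpn p n)) (c : Zpn p n → ℂ) :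
    (∑ x, f x * conj (∑ r ∈ S, c r * character r x)) / (p : ℂ) ^ n =
      ∑ r ∈ S, conj (c r) * fourierCoeff f r := by
  simp only [fourierCoeff, map_sum, map_mul, Finset.mul_sum, Finset.sum_div]
  rw [Finset.sum_comm]
  refine Finset.sum_congr rfl fun r _ => Finset.sum_congr rfl fun x _ => ?_
  ring

theorem parseval (f : Zpn p n → ℂ) :
    ∑ r, ‖fourierCoeff f r‖ ^ 2 = (∑ x, ‖f x‖ ^ 2) / (p : ℝ) ^ n := by
  have h := sum_mul_conj_sum_character f Finset.univ (fourierCoeff f)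
  simp only [sum_fourierCoeff_mul_character, Complex.mul_conj', Complex.conj_mul'] at h
  exact_mod_cast h.symm

theorem norm_toComplex {X : Type} (f : X → ℤˣ) (x : X) : ‖toComplex f x‖ = 1 := by
  rcases Int.units_eq_one_or (f x) with h | h <;> simp [toComplex, h]

theorem toComplex_mul_self {X : Type} (f : X → ℤˣ) (x : X) :
    toComplex f x * toComplex f x = 1 := by
  rcases Int.units_eq_one_or (f x) with h | h <;> simp [toComplex, h]

theorem conj_toComplex {X : Type} (f : X → ℤˣ) (x : X) :
    conj (toComplex f x) = toComplex f x := by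
  simp [toComplex]

theorem sum_norm_sq_fourierCoeff_toComplex (f : Zpn p n → ℤˣ) :
    ∑ r, ‖fourierCoeff (toComplex f) r‖ ^ 2 = 1 := by
  have hp : ((p : ℝ) ^ n) ≠ 0 := by
    have := (Fact.out : p.Prime).ne_zero
    positivity
  rw [parseval]
  simp [norm_toComplex, hp]

theorem norm_fourierCoeff_toComplex_le_one (f : Zpn p n → ℤˣ) (r : Zpn p n) :
    ‖fourierCoeff (toComplex f) r‖ ≤ 1 := by
  have h := Finset.single_le_sum (f := fun r => ‖fourierCoeff (toComplex f) r‖ ^ 2)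
    (fun i _ => by positivity) (Finset.mem_univ r)
  rw [sum_norm_sq_fourierCoeff_toComplex] at h
  exact (sq_le_one_iff₀ (norm_nonneg _)).1 h

/-- A Boolean-valued function is never zero, so it has at least one Fourier coefficient. -/
theorem not_isSparse_zero (f : Zpn p n → ℤˣ) : ¬ IsSparse 0 f := by
  intro h
  have h0 : fourierSupport (toComplex f) = ∅ :=
    (Set.ncard_eq_zero (Set.toFinite _)).1 (Nat.le_zero.1 h)
  have h1 := sum_norm_sq_fourierCoeff_toComplex f
  have h2 : ∀ r, fourierCoeff (toComplex f) r = 0 := fun r => by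
    by_contra hr
    exact (Set.eq_empty_iff_forall_notMem.1 h0 r) hr
  simp [h2] at h1

/-- Sparsity is inherited by restrictions along linear maps. -/
theorem IsSparse.comp_mulVec {s : ℕ} {f : Zpn p n → ℤˣ} (hf : IsSparse s f)
    (M : Matrix (Fin n) (Fin k) (ZMod p)) : IsSparse s fun y => f (M.mulVec y) := by
  refine le_trans ?_ hf
  have hsub : fourierSupport (toComplex fun y => f (M.mulVec y)) ⊆
      (fun r => Matrix.vecMul r M) '' fourierSupport (toComplex f) := by
    intro u hu
    have hu' : fourierCoeff (fun y => toComplex f (M.mulVec y)) u ≠ 0 := hu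
    rw [fourierCoeff_comp_mulVec] at hu'
    obtain ⟨r, -, hr⟩ := Finset.exists_ne_zero_of_sum_ne_zero hu'
    simp only [ne_eq, ite_eq_right_iff, Classical.not_imp] at hr
    exact ⟨r, hr.2, hr.1⟩
  exact (Set.ncard_le_ncard hsub (Set.toFinite _)).trans (Set.ncard_image_le (Set.toFinite _))

/-- The sum of the fourth powers of the Fourier coefficients is an average over
parallelograms (a Gowers `U²` norm). -/
theorem sum_norm_pow_four_fourierCoeff (h : Zpn p n → ℂ) :
    ((∑ r, ‖fourierCoeff h r‖ ^ 4 : ℝ) : ℂ) = (∑ v : Fin 3 → Zpn p n,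
      h (v 0) * h (v 0 + v 1 + v 2) * conj (h (v 0 + v 1)) * conj (h (v 0 + v 2))) /
        ((p : ℂ) ^ n) ^ 3 := by
  -- `a` is the conjugate of the autocorrelation of `h`; its Fourier coefficients are `|ĥ|²`.
  let a : Zpn p n → ℂ := fun d => (∑ y, conj (h y) * h (y + d)) / (p : ℂ) ^ n
  have ha : ∀ r, fourierCoeff a r = (‖fourierCoeff h r‖ ^ 2 : ℂ) := by
    intro r
    rw [← Complex.mul_conj']
    simp only [fourierCoeff, a, map_div₀, map_sum, map_mul, Complex.conj_conj, map_pow,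
      map_natCast, Finset.sum_div, Finset.sum_mul, Finset.mul_sum]
    rw [Finset.sum_comm]
    refine Finset.sum_congr rfl fun y _ => ?_
    refine Fintype.sum_equiv (Equiv.addLeft y) _ _ fun d => ?_
    have hy : conj (character r y) * character r y = 1 := by
      rw [Complex.conj_mul', norm_character]; simp
    simp only [Equiv.coe_addLeft, character_add_right, map_mul]
    linear_combination
      (-(conj (h y) * h (y + d) * conj (character r d) / (p : ℂ) ^ n / (p : ℂ) ^ n)) * hy
  have hpar : ((∑ r, ‖fourierCoeff h r‖ ^ 4 : ℝ) : ℂ) =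
      (∑ d, a d * conj (a d)) / (p : ℂ) ^ n := by
    have h1 := parseval a
    simp only [ha, ← Complex.ofReal_pow, Complex.norm_real, Real.norm_eq_abs, sq_abs,
      ← pow_mul] at h1
    rw [h1]
    simp [Complex.mul_conj']
  rw [hpar]
  let e : (Fin 3 → Zpn p n) ≃ Zpn p n × Zpn p n × Zpn p n :=
    { toFun := fun v => (v 1, v 0, v 2)
      invFun := fun t => ![t.2.1, t.1, t.2.2]
      left_inv := fun v => by ext i; fin_cases i <;> rfl
      right_inv := fun t => rfl }
  rw [Fintype.sum_equiv e
    (fun v => h (v 0) * h (v 0 + v 1 + v 2) * conj (h (v 0 + v 1)) * conj (h (v 0 + v 2)))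
    (fun t => h t.2.1 * h (t.2.1 + t.1 + t.2.2) *
    conj (h (t.2.1 + t.1)) * conj (h (t.2.1 + t.2.2))) fun v => rfl]
  simp only [Fintype.sum_prod_type, Finset.sum_div, a, map_div₀, map_sum, map_mul,
    Complex.conj_conj, map_pow, map_natCast, Finset.mul_sum, Finset.sum_mul]
  refine Finset.sum_congr rfl fun d _ => ?_
  refine Finset.sum_congr rfl fun y _ => ?_
  refine (Fintype.sum_equiv (Equiv.addLeft y) _ _ fun d' => ?_).symm
  simp only [Equiv.coe_addLeft, add_right_comm y d d']
  ring

/-! ### Random linear maps -/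

/-- A surjective homomorphism of finite groups maps the uniform distribution to the uniform
distribution. -/
theorem card_mul_sum_comp_of_surjective {G H : Type*} [AddCommGroup G] [AddCommGroup H] [Fintype G]
    [Fintype H] (φ : G →+ H) (hφ : Function.Surjective φ) (F : H → ℂ) :
    (Fintype.card H : ℂ) * ∑ g, F (φ g) = Fintype.card G * ∑ h, F h := by
  classical
  have hfib : ∀ h, (Finset.univ.filter fun g => φ g = h).card =
      (Finset.univ.filter fun g => φ g = 0).card := fun h =>
    AddMonoidHom.card_fiber_eq_of_mem_range φ (hφ h) (hφ 0)
  have hG : Fintype.card G = Fintype.card H * (Finset.univ.filter fun g => φ g = 0).card := by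
    rw [← Finset.card_univ, Finset.card_eq_sum_card_fiberwise (f := φ) (t := Finset.univ) (by simp)]
    simp [hfib]
  have hs : ∑ g, F (φ g) = ∑ h, (Finset.univ.filter fun g => φ g = 0).card * F h := by
    rw [← Finset.sum_fiberwise_of_maps_to (g := φ) (t := Finset.univ) (by simp)]
    refine Finset.sum_congr rfl fun h _ => ?_
    rw [Finset.sum_congr rfl fun g hg => by rw [(Finset.mem_filter.1 hg).2], Finset.sum_const, hfib,
      nsmul_eq_mul]
  rw [hs, ← Finset.mul_sum, hG]
  push_cast
  ring

theorem card_Zpn : Fintype.card (Zpn p n) = p ^ n := by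
  simp

/-- A fixed non-zero vector is killed by a random linear map to `ℤ_p^k` with probability
`p^{-k}`. -/
theorem pow_mul_card_vecMul_eq_zero {r : Zpn p n} (hr : r ≠ 0) :
    p ^ k * (Finset.univ.filter fun M : Matrix (Fin n) (Fin k) (ZMod p) =>
      Matrix.vecMul r M = 0).card = Fintype.card (Matrix (Fin n) (Fin k) (ZMod p)) := by
  classical
  obtain ⟨i, hi⟩ := Function.ne_iff.1 hr
  let φ : Matrix (Fin n) (Fin k) (ZMod p) →+ Zpn p k :=
    { toFun := fun M => Matrix.vecMul r M
      map_zero' := Matrix.vecMul_zero r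
      map_add' := fun A B => Matrix.vecMul_add A B r }
  have hφ : Function.Surjective φ := fun u => by
    refine ⟨Matrix.vecMulVec (Pi.single i (r i)⁻¹) u, ?_⟩
    have hi' : r i ≠ 0 := hi
    simp [φ, Matrix.vecMul_vecMulVec, hi']
  have h := card_mul_sum_comp_of_surjective φ hφ fun u => if u = 0 then 1 else 0
  rw [card_Zpn] at h
  simp only [Finset.sum_boole, φ, AddMonoidHom.coe_mk, ZeroHom.coe_mk] at h
  simp only [Finset.filter_eq', Finset.mem_univ, if_true, Finset.card_singleton,
    Nat.cast_one, mul_one] at h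
  exact_mod_cast h

/-- Union bound over a finite set of non-zero vectors. -/
theorem pow_mul_card_exists_vecMul_eq_zero_le (E : Finset (Zpn p n)) (hE : (0 : Zpn p n) ∉ E) :
    p ^ k * (Finset.univ.filter fun M : Matrix (Fin n) (Fin k) (ZMod p) =>
      ∃ d ∈ E, Matrix.vecMul d M = 0).card ≤
        E.card * Fintype.card (Matrix (Fin n) (Fin k) (ZMod p)) := by
  classical
  have h1 : (Finset.univ.filter fun M : Matrix (Fin n) (Fin k) (ZMod p) =>
      ∃ d ∈ E, Matrix.vecMul d M = 0) ⊆ E.biUnion fun d =>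
        Finset.univ.filter fun M : Matrix (Fin n) (Fin k) (ZMod p) => Matrix.vecMul d M = 0 := by
    intro M hM
    simpa using hM
  calc _ ≤ p ^ k * ∑ d ∈ E, (Finset.univ.filter fun M : Matrix (Fin n) (Fin k) (ZMod p) =>
          Matrix.vecMul d M = 0).card :=
        Nat.mul_le_mul_left _ ((Finset.card_le_card h1).trans Finset.card_biUnion_le)
    _ = _ := by
        rw [Finset.mul_sum, Finset.sum_congr rfl fun d hd =>
          pow_mul_card_vecMul_eq_zero (k := k) (ne_of_mem_of_not_mem hd hE)]
        simp

theorem pow_mul_card_not_injOn_vecMul_le (S : Finset (Zpn p n)) :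
    p ^ k * (Finset.univ.filter fun M : Matrix (Fin n) (Fin k) (ZMod p) =>
      ¬ Set.InjOn (fun r => Matrix.vecMul r M) (S : Set (Zpn p n))).card ≤
        S.card ^ 2 * Fintype.card (Matrix (Fin n) (Fin k) (ZMod p)) := by
  classical
  let E : Finset (Zpn p n) := S.offDiag.image fun a => a.1 - a.2
  have hE : (0 : Zpn p n) ∉ E := by
    simp only [E, Finset.mem_image, Finset.mem_offDiag, not_exists, not_and]
    rintro a ⟨-, -, ha⟩ h
    exact ha (sub_eq_zero.1 h)
  have hcard : E.card ≤ S.card ^ 2 := by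
    refine Finset.card_image_le.trans ?_
    rw [Finset.offDiag_card, sq]
    exact Nat.sub_le _ _
  refine le_trans (Nat.mul_le_mul_left _ (Finset.card_le_card ?_))
    ((pow_mul_card_exists_vecMul_eq_zero_le E hE).trans (Nat.mul_le_mul_right _ hcard))
  intro M hM
  simp only [Finset.mem_filter, Finset.mem_univ, true_and, Set.InjOn, not_forall] at hM ⊢
  obtain ⟨a, ha, b, hb, hab, hne⟩ := hM
  refine ⟨a - b, Finset.mem_image.2 ⟨(a, b), Finset.mem_offDiag.2 ⟨ha, hb, hne⟩, rfl⟩, ?_⟩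
  rw [Matrix.sub_vecMul, hab, sub_self]

/-- If `p ^ k` exceeds the size of `S`, some linear map to `ℤ_p^k` separates a given vector from
all the other elements of `S`. -/
theorem exists_vecMul_ne (S : Finset (Zpn p n)) (hS : S.card < p ^ k) (r : Zpn p n) :
    ∃ M : Matrix (Fin n) (Fin k) (ZMod p),
      ∀ r' ∈ S, r' ≠ r → Matrix.vecMul r' M ≠ Matrix.vecMul r M := by
  classical
  let E : Finset (Zpn p n) := (S.erase r).image fun a => a - r
  have hE : (0 : Zpn p n) ∉ E := by simp [E, sub_eq_zero]
  have hcard : E.card ≤ S.card :=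
    Finset.card_image_le.trans (Finset.card_le_card (Finset.erase_subset _ _))
  by_contra! hcon
  have huniv : (Finset.univ.filter fun M : Matrix (Fin n) (Fin k) (ZMod p) =>
      ∃ d ∈ E, Matrix.vecMul d M = 0) = Finset.univ := by
    refine Finset.filter_true_of_mem fun M _ => ?_
    obtain ⟨r', hr', hne, h⟩ := hcon M
    exact ⟨r' - r, Finset.mem_image.2 ⟨r', Finset.mem_erase.2 ⟨hne, hr'⟩, rfl⟩,
      by rw [Matrix.sub_vecMul, h, sub_self]⟩
  have h := pow_mul_card_exists_vecMul_eq_zero_le (k := k) E hE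
  rw [huniv, Finset.card_univ] at h
  have := Nat.le_of_mul_le_mul_right h Fintype.card_pos
  omega

/-- A random linear map sends linearly independent vectors to independent uniform vectors. -/
theorem sum_comp_mulVec_of_linearIndependent {ι : Type*} [Fintype ι] [DecidableEq ι]
    (v : ι → Zpn p k) (hv : LinearIndependent (ZMod p) v) (F : (ι → Zpn p n) → ℂ) :
    (Fintype.card (ι → Zpn p n) : ℂ) *
        ∑ M : Matrix (Fin n) (Fin k) (ZMod p), F (fun i => M.mulVec (v i)) =
      Fintype.card (Matrix (Fin n) (Fin k) (ZMod p)) * ∑ w, F w := by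
  let φ : Matrix (Fin n) (Fin k) (ZMod p) →+ (ι → Zpn p n) :=
    { toFun := fun M i => M.mulVec (v i)
      map_zero' := by ext; simp
      map_add' := fun A B => by ext; simp [Matrix.add_mulVec] }
  refine card_mul_sum_comp_of_surjective φ (fun w => ?_) F
  let b := Module.Basis.sumExtend hv
  let T : Zpn p k →ₗ[ZMod p] Zpn p n := b.constr (ZMod p) (Sum.elim w 0)
  refine ⟨LinearMap.toMatrix' T, ?_⟩
  funext i
  have hb : b (Sum.inl i) = v i := by
    simp [b, Module.Basis.sumExtend]
    rfl
  change (LinearMap.toMatrix' T).mulVec (v i) = w i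
  rw [LinearMap.toMatrix'_mulVec, ← hb]
  simp [T]

/-- Few triples of vectors are linearly dependent. -/
theorem card_not_linearIndependent_le :
    (Nat.card {v : Fin 3 → Zpn p k // ¬ LinearIndependent (ZMod p) v} : ℝ) * (p : ℝ) ^ k ≤
      3 * (p : ℝ) ^ 2 * ((p : ℝ) ^ k) ^ 3 := by
  have hp1 : (1 : ℝ) ≤ p := by exact_mod_cast (Fact.out : p.Prime).one_le
  have hQ0 : (0 : ℝ) < (p : ℝ) ^ k := by positivity
  have htot : Nat.card {v : Fin 3 → Zpn p k // LinearIndependent (ZMod p) v} +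
      Nat.card {v : Fin 3 → Zpn p k // ¬ LinearIndependent (ZMod p) v} = (p ^ k) ^ 3 := by
    classical
    rw [Nat.card_eq_fintype_card, Nat.card_eq_fintype_card,
      ← Fintype.card_sum, Fintype.card_congr (Equiv.sumCompl _)]
    simp
  have htot' : (Nat.card {v : Fin 3 → Zpn p k // LinearIndependent (ZMod p) v} : ℝ) +
      Nat.card {v : Fin 3 → Zpn p k // ¬ LinearIndependent (ZMod p) v} = ((p : ℝ) ^ k) ^ 3 := by
    exact_mod_cast htot
  rcases lt_or_ge k 3 with hk | hk
  · have h1 : (p : ℝ) ^ k ≤ p ^ 2 := pow_le_pow_right₀ hp1 (by omega)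
    have h2 : (Nat.card {v : Fin 3 → Zpn p k // ¬ LinearIndependent (ZMod p) v} : ℝ) ≤
        ((p : ℝ) ^ k) ^ 3 := by
      rw [← htot']
      simp
    calc _ ≤ ((p : ℝ) ^ k) ^ 3 * p ^ 2 := by gcongr
      _ ≤ _ := by nlinarith [mul_nonneg (pow_pos hQ0 3).le (sq_nonneg (p : ℝ))]
  · have hcard := card_linearIndependent (K := ZMod p) (V := Zpn p k) (k := 3) (by simpa using hk)
    simp only [ZMod.card, Module.finrank_fintype_fun_eq_card,
      Fintype.card_fin, Fin.prod_univ_three] at hcard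
    have hsub : ∀ i ≤ 3, ((p ^ k - p ^ i : ℕ) : ℝ) = (p : ℝ) ^ k - (p : ℝ) ^ i := fun i hi => by
      rw [Nat.cast_sub (Nat.pow_le_pow_right (Fact.out : p.Prime).one_le (hi.trans hk))]
      simp
    have hcard' : (Nat.card {v : Fin 3 → Zpn p k // LinearIndependent (ZMod p) v} : ℝ) =
        ((p : ℝ) ^ k - 1) * ((p : ℝ) ^ k - p) * ((p : ℝ) ^ k - (p : ℝ) ^ 2) := by
      rw [hcard]
      push_cast
      rw [hsub _ (by simp), hsub _ (by simp), hsub _ (by simp)]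
      simp
    have hQ3 : (p : ℝ) ^ 3 ≤ (p : ℝ) ^ k := pow_le_pow_right₀ hp1 hk
    rw [hcard'] at htot'
    have hdep : (Nat.card {v : Fin 3 → Zpn p k // ¬ LinearIndependent (ZMod p) v} : ℝ) ≤
        3 * (p : ℝ) ^ 2 * ((p : ℝ) ^ k) ^ 2 := by
      generalize (p : ℝ) ^ k = Q at *
      generalize (p : ℝ) = x at *
      have e1 : x ^ 3 ≤ Q * x := by nlinarith
      have e2 : (1 + x + x ^ 2) * Q ^ 2 ≤ 3 * x ^ 2 * Q ^ 2 :=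
        mul_le_mul_of_nonneg_right (by nlinarith) (sq_nonneg Q)
      have e3 : 0 ≤ Q * (x ^ 2 + x ^ 3) := by positivity
      nlinarith
    calc _ ≤ 3 * (p : ℝ) ^ 2 * ((p : ℝ) ^ k) ^ 2 * (p : ℝ) ^ k := by gcongr
      _ = _ := by ring

/-! ### Granularity of sparse Boolean-valued functions -/

/-- The lower bound on sums of signed roots of unity, over a model `K` of the cyclotomic field.
The norm of such a sum is a non-zero integer, and each conjugate has absolute value at most the
number of terms. -/
theorem one_le_norm_sum_mul_pow_of_isCyclotomicExtension (K : Type) [Field K] [CharZero K]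
    [IsCyclotomicExtension {p} ℚ K] {X : Type} [Fintype X] (f : X → ℤˣ) (e : X → ZMod p)
    (h0 : ∑ x, toComplex f x * ZMod.stdAddChar (e x) ≠ 0) :
    1 ≤ ‖∑ x, toComplex f x * ZMod.stdAddChar (e x)‖ * (Fintype.card X : ℝ) ^ (p - 2) := by
  have hp : p.Prime := Fact.out
  have : NeZero p := ⟨hp.ne_zero⟩
  have := IsCyclotomicExtension.numberField {p} ℚ K
  have hζ := IsCyclotomicExtension.zeta_spec p ℚ K
  set ζ := IsCyclotomicExtension.zeta p ℚ K
  let α : K := ∑ x, ((f x : ℤ) : K) * ζ ^ (e x).val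
  have hint : IsIntegral ℤ α := by
    refine IsIntegral.sum _ fun x _ => ?_
    refine IsIntegral.mul ?_ ((hζ.isIntegral hp.pos).pow _)
    simpa using isIntegral_algebraMap (R := ℤ) (A := K) (x := (f x : ℤ))
  have hroot : IsPrimitiveRoot (ZMod.stdAddChar (1 : ZMod p) : ℂ) p := by
    rw [← Int.cast_one, ZMod.stdAddChar_coe]
    simpa using Complex.isPrimitiveRoot_exp p hp.ne_zero
  -- the embedding of the cyclotomic field taking `ζ` to `exp (2πi / p)`
  obtain ⟨σ₀, hσ₀⟩ : ∃ σ : K →ₐ[ℚ] ℂ, σ ζ = ZMod.stdAddChar (1 : ZMod p) := by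
    have hirr := Polynomial.cyclotomic.irreducible_rat hp.pos
    refine ⟨(hζ.embeddingsEquivPrimitiveRoots ℂ hirr).symm
      ⟨_, (mem_primitiveRoots hp.pos).2 hroot⟩, ?_⟩
    rw [← hζ.embeddingsEquivPrimitiveRoots_apply_coe ℂ hirr, Equiv.apply_symm_apply]
  have hα : σ₀ α = ∑ x, toComplex f x * ZMod.stdAddChar (e x) := by
    simp only [α, map_sum, map_mul, map_pow, hσ₀, map_intCast, toComplex]
    refine Finset.sum_congr rfl fun x _ => ?_
    rw [← AddChar.map_nsmul_eq_pow]
    simp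
  have hα0 : α ≠ 0 := by
    rintro h
    rw [h, map_zero] at hα
    exact h0 hα.symm
  have hbound : ∀ σ : K →ₐ[ℚ] ℂ, ‖σ α‖ ≤ Fintype.card X := by
    intro σ
    have hσ : ‖σ ζ‖ = 1 := (hζ.map_of_injective σ.injective).norm'_eq_one hp.ne_zero
    simp only [α, map_sum, map_mul, map_pow, map_intCast]
    have hf : ∀ x, ‖((f x : ℤ) : ℂ)‖ = 1 := norm_toComplex f
    refine (norm_sum_le _ _).trans (le_of_eq ?_)
    simp only [norm_mul, norm_pow, hσ, hf, one_pow, mul_one, Finset.sum_const, Finset.card_univ,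
      nsmul_eq_mul]
  have hnorm : (1 : ℝ) ≤ ∏ σ : K →ₐ[ℚ] ℂ, ‖σ α‖ := by
    obtain ⟨z, hz⟩ := IsIntegrallyClosed.isIntegral_iff.1 (Algebra.isIntegral_norm ℚ hint)
    have hz0 : z ≠ 0 := by
      rintro rfl
      rw [map_zero] at hz
      exact hα0 (Algebra.norm_eq_zero_iff.1 hz.symm)
    have := Algebra.norm_eq_prod_embeddings ℚ ℂ α
    rw [← norm_prod, ← this, ← hz]
    simpa using by exact_mod_cast Int.one_le_abs hz0
  have hcard : Fintype.card (K →ₐ[ℚ] ℂ) = p - 1 := by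
    rw [AlgHom.card, IsCyclotomicExtension.finrank K (Polynomial.cyclotomic.irreducible_rat hp.pos),
      Nat.totient_prime hp]
  classical
  rw [← Finset.mul_prod_erase _ _ (Finset.mem_univ σ₀), hα] at hnorm
  refine hnorm.trans (mul_le_mul_of_nonneg_left ?_ (norm_nonneg _))
  refine (Finset.prod_le_prod (fun _ _ => norm_nonneg _) fun σ _ => hbound σ).trans ?_
  rw [Finset.prod_const, Finset.card_erase_of_mem (Finset.mem_univ _), Finset.card_univ, hcard,
    Nat.sub_sub]

/-- A non-zero sum of `N` signed `p`-th roots of unity has absolute value at least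
`N ^ (-(p - 2))`. -/
theorem one_le_norm_sum_mul_pow {X : Type} [Fintype X] (f : X → ℤˣ) (e : X → ZMod p)
    (h0 : ∑ x, toComplex f x * ZMod.stdAddChar (e x) ≠ 0) :
    1 ≤ ‖∑ x, toComplex f x * ZMod.stdAddChar (e x)‖ * (Fintype.card X : ℝ) ^ (p - 2) :=
  have : NeZero p := ⟨(Fact.out : p.Prime).ne_zero⟩
  have : IsCyclotomicExtension {p} ℚ (CyclotomicField p ℚ) := by
    -- The two `ℚ`-algebra structures at hand agree, as any two do.
    have h : (DivisionRing.toRatAlgebra : Algebra ℚ (CyclotomicField p ℚ)) =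
        CyclotomicField.algebra p ℚ := Subsingleton.elim _ _
    rw [h]
    exact CyclotomicField.isCyclotomicExtension p ℚ
  one_le_norm_sum_mul_pow_of_isCyclotomicExtension (CyclotomicField p ℚ) f e h0

/-- Granularity: the non-zero Fourier coefficients of an `s`-sparse Boolean-valued function are
bounded below in terms of `p` and `s` alone. Folding to a space of dimension `t` with
`s < p ^ t ≤ p * s`, in which the given frequency stays isolated, removes the dependence on `n`. -/
theorem one_le_pow_mul_norm_fourierCoeff {s : ℕ} {f : Zpn p n → ℤˣ} (hf : IsSparse s f)
    {r : Zpn p n} (hr : fourierCoeff (toComplex f) r ≠ 0) :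
    1 ≤ ((p : ℝ) * s) ^ (p - 1) * ‖fourierCoeff (toComplex f) r‖ := by
  classical
  have hp : p.Prime := Fact.out
  have hs : s ≠ 0 := by
    rintro rfl
    exact not_isSparse_zero f hf
  let S : Finset (Zpn p n) := Finset.univ.filter fun r => fourierCoeff (toComplex f) r ≠ 0
  have hS : S.card ≤ s := by
    refine le_of_eq_of_le ?_ hf
    rw [fourierSparsity, ← Set.ncard_coe_finset]
    congr 1
    ext
    simp [S, fourierSupport]
  let t := Nat.log p s + 1
  have ht : s < p ^ t := Nat.lt_pow_succ_log_self hp.one_lt s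
  have ht' : p ^ t ≤ p * s := by
    rw [pow_succ, mul_comm]
    exact Nat.mul_le_mul_left p (Nat.pow_log_le_self p hs)
  obtain ⟨M, hM⟩ := exists_vecMul_ne (k := t) S (hS.trans_lt ht) r
  have hfold : fourierCoeff (fun y => toComplex f (M.mulVec y)) (Matrix.vecMul r M) =
      fourierCoeff (toComplex f) r := by
    rw [fourierCoeff_comp_mulVec, Finset.sum_eq_single r]
    · simp
    · intro r' _ hne
      by_cases h : r' ∈ S
      · rw [if_neg (hM r' h hne)]
      · have h0 : fourierCoeff (toComplex f) r' = 0 := by simpa [S] using h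
        simp [h0]
    · simp
  have hsum : ∑ y, toComplex (fun y => f (M.mulVec y)) y *
      ZMod.stdAddChar (-(Matrix.vecMul r M) ⬝ᵥ y) =
        (p : ℂ) ^ t * fourierCoeff (toComplex f) r := by
    rw [← hfold, fourierCoeff, mul_div_cancel₀ _ (pow_ne_zero _ (Nat.cast_ne_zero.2 hp.ne_zero))]
    refine Finset.sum_congr rfl fun y _ => ?_
    rw [conj_character]
    rfl
  have h := one_le_norm_sum_mul_pow (fun y => f (M.mulVec y))
    (fun y => -(Matrix.vecMul r M) ⬝ᵥ y) (by
      rw [hsum]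
      exact mul_ne_zero (pow_ne_zero _ (Nat.cast_ne_zero.2 hp.ne_zero)) hr)
  rw [hsum, card_Zpn, norm_mul, norm_pow, Complex.norm_natCast] at h
  have hexp : p - 1 = (p - 2) + 1 := by have := hp.two_le; omega
  have hle : ((p : ℝ) ^ t) ≤ p * s := by exact_mod_cast ht'
  calc (1 : ℝ) ≤ ((p : ℝ) ^ t) ^ (p - 1) * ‖fourierCoeff (toComplex f) r‖ := by
        rw [hexp, pow_succ]
        push_cast at h
        linarith
    _ ≤ _ := by gcongr

/-! ### Lifting a sparse restriction -/

/-- The part of `f` carried by the frequencies outside `L`. -/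
noncomputable def remainder (f : Zpn p n → ℂ) (L : Finset (Zpn p n)) (x : Zpn p n) : ℂ :=
  ∑ r ∈ Lᶜ, fourierCoeff f r * character r x

theorem fourierCoeff_remainder (f : Zpn p n → ℂ) (L : Finset (Zpn p n)) (u : Zpn p n) :
    fourierCoeff (remainder f L) u = if u ∈ L then 0 else fourierCoeff f u := by
  have h := fourierCoeff_sum_character Lᶜ (fourierCoeff f) (fun r => r) u
  rw [show remainder f L = fun x => ∑ r ∈ Lᶜ, fourierCoeff f r * character r x from rfl, h,
    Finset.sum_ite_eq' Lᶜ u]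
  simp only [Finset.mem_compl]
  split_ifs <;> rfl

theorem norm_remainder_le (f : Zpn p n → ℤˣ) (L : Finset (Zpn p n)) (x : Zpn p n) :
    ‖remainder (toComplex f) L x‖ ≤ 1 + L.card := by
  have h : remainder (toComplex f) L x =
      toComplex f x - ∑ r ∈ L, fourierCoeff (toComplex f) r * character r x := by
    rw [← sum_fourierCoeff_mul_character (toComplex f) x, ← Finset.sum_add_sum_compl L, remainder]
    ring
  rw [h]
  refine (norm_sub_le _ _).trans (add_le_add (norm_toComplex f x).le ((norm_sum_le _ _).trans ?_))
  refine (Finset.sum_le_card_nsmul _ _ 1 fun r _ => ?_).trans (by simp)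
  rw [norm_mul, norm_character, mul_one]
  exact norm_fourierCoeff_toComplex_le_one f r

/-- On average over linear maps, folding does not increase the sum of the fourth powers of the
Fourier coefficients by much: parallelograms spanned by linearly independent vectors are mapped to
uniformly random parallelograms, and the others are rare. -/
theorem sum_sum_norm_pow_four_fourierCoeff_comp_le (h : Zpn p n → ℂ) {B : ℝ}
    (hB : ∀ x, ‖h x‖ ≤ B) :
    ∑ M : Matrix (Fin n) (Fin k) (ZMod p), ∑ u, ‖fourierCoeff (fun y => h (M.mulVec y)) u‖ ^ 4 ≤
      Fintype.card (Matrix (Fin n) (Fin k) (ZMod p)) *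
        (∑ r, ‖fourierCoeff h r‖ ^ 4 + B ^ 4 * (3 * (p : ℝ) ^ 2 / (p : ℝ) ^ k)) := by
  classical
  have hp0 : (p : ℝ) ≠ 0 := Nat.cast_ne_zero.2 (Fact.out : p.Prime).ne_zero
  have hpC : (p : ℂ) ≠ 0 := Nat.cast_ne_zero.2 (Fact.out : p.Prime).ne_zero
  have hpk : (0 : ℝ) < (p : ℝ) ^ k := by positivity
  have hB0 : 0 ≤ B := (norm_nonneg _).trans (hB 0)
  let Φ : (Fin 3 → Zpn p n) → ℂ := fun v =>
    h (v 0) * h (v 0 + v 1 + v 2) * conj (h (v 0 + v 1)) * conj (h (v 0 + v 2))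
  have hΦ : ∀ v, ‖Φ v‖ ≤ B ^ 4 := fun v => by
    simp only [Φ, norm_mul, RCLike.norm_conj]
    calc _ ≤ B * B * B * B := by gcongr <;> exact hB _
      _ = B ^ 4 := by ring
  obtain ⟨U, hU⟩ : ∃ U : ℝ, U = ∑ r, ‖fourierCoeff h r‖ ^ 4 := ⟨_, rfl⟩
  obtain ⟨N, hN⟩ : ∃ N : ℝ, N = (Fintype.card (Matrix (Fin n) (Fin k) (ZMod p)) : ℕ) := ⟨_, rfl⟩
  have hN0 : 0 ≤ N := hN ▸ Nat.cast_nonneg _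
  rw [← hN, ← hU]
  have hU0 : 0 ≤ U := by rw [hU]; positivity
  let G : (Fin 3 → Zpn p k) → ℂ := fun v =>
    ∑ M : Matrix (Fin n) (Fin k) (ZMod p), Φ fun i => M.mulVec (v i)
  have hG : ∀ v, ‖G v‖ ≤ N * U + if LinearIndependent (ZMod p) v then 0 else N * B ^ 4 := by
    intro v
    split_ifs with hv
    · have h1 := sum_comp_mulVec_of_linearIndependent (n := n) v hv Φ
      have h2 := sum_norm_pow_four_fourierCoeff h
      rw [eq_div_iff (by positivity)] at h2
      have hc : (Fintype.card (Fin 3 → Zpn p n) : ℂ) = ((p : ℂ) ^ n) ^ 3 := by simp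
      rw [hc, ← h2, ← hU] at h1
      have h3 : G v = ((N * U : ℝ) : ℂ) := by
        have hne : ((p : ℂ) ^ n) ^ 3 ≠ 0 := by positivity
        apply mul_left_cancel₀ hne
        rw [show G v = ∑ M : Matrix (Fin n) (Fin k) (ZMod p), Φ fun i => M.mulVec (v i) from rfl,
          h1, hN]
        push_cast
        ring
      rw [h3, Complex.norm_real, Real.norm_of_nonneg (mul_nonneg hN0 hU0), add_zero]
    · calc ‖G v‖ ≤ ∑ M : Matrix (Fin n) (Fin k) (ZMod p), ‖Φ fun i => M.mulVec (v i)‖ :=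
            norm_sum_le _ fun M : Matrix (Fin n) (Fin k) (ZMod p) => Φ fun i => M.mulVec (v i)
        _ ≤ ∑ M : Matrix (Fin n) (Fin k) (ZMod p), B ^ 4 :=
            Finset.sum_le_sum fun M _ => hΦ fun i => M.mulVec (v i)
        _ = N * B ^ 4 := by simp [hN]
        _ ≤ N * U + N * B ^ 4 := le_add_of_nonneg_left (mul_nonneg hN0 hU0)
  -- average the parallelogram formula for `h ∘ M` over `M`
  have hC : ((∑ M : Matrix (Fin n) (Fin k) (ZMod p),
      ∑ u, ‖fourierCoeff (fun y => h (M.mulVec y)) u‖ ^ 4 : ℝ) : ℂ) =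
        (∑ v, G v) / ((p : ℂ) ^ k) ^ 3 := by
    rw [Complex.ofReal_sum, Finset.sum_comm, Finset.sum_div]
    refine Finset.sum_congr rfl fun M _ => ?_
    rw [sum_norm_pow_four_fourierCoeff]
    simp only [Φ, Matrix.mulVec_add]
  have hS0 : 0 ≤ ∑ M : Matrix (Fin n) (Fin k) (ZMod p),
      ∑ u, ‖fourierCoeff (fun y => h (M.mulVec y)) u‖ ^ 4 := by positivity
  rw [← Real.norm_of_nonneg hS0, ← Complex.norm_real, hC, norm_div, norm_pow, norm_pow,
    Complex.norm_natCast, div_le_iff₀ (by positivity)]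
  have hdep := card_not_linearIndependent_le (p := p) (k := k)
  rw [Nat.card_eq_fintype_card, Fintype.card_subtype, ← le_div_iff₀ hpk] at hdep
  calc ‖∑ v, G v‖ ≤ ∑ v : Fin 3 → Zpn p k,
        (N * U + if LinearIndependent (ZMod p) v then 0 else N * B ^ 4) :=
      (norm_sum_le _ _).trans (Finset.sum_le_sum fun v _ => hG v)
    _ = ((p : ℝ) ^ k) ^ 3 * (N * U) + (Finset.univ.filter fun v : Fin 3 → Zpn p k =>
          ¬ LinearIndependent (ZMod p) v).card * (N * B ^ 4) := by
      rw [Finset.sum_add_distrib, Finset.sum_ite]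
      simp
    _ ≤ ((p : ℝ) ^ k) ^ 3 * (N * U) +
          (3 * (p : ℝ) ^ 2 * ((p : ℝ) ^ k) ^ 3 / (p : ℝ) ^ k) * (N * B ^ 4) := by gcongr
    _ = _ := by ring

/-- If a linear map separates the sums of two frequencies from `L`, if the restriction of the
Boolean-valued function `f` along this map is `s`-sparse, and if the remainder of `f` outside `L`
contributes little to each folded coefficient, then `f` is close to an `s`-sparse Boolean-valued
function. -/
theorem exists_isSparse_close {s : ℕ} {ρ : ℝ} (f : Zpn p n → ℤˣ) (L : Finset (Zpn p n))
    (M : Matrix (Fin n) (Fin k) (ZMod p))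
    (hinj : Set.InjOn (fun r => Matrix.vecMul r M)
      (insert 0 ((L ×ˢ L).image fun a => a.1 + a.2) : Finset (Zpn p n)))
    (hs : IsSparse s fun y => f (M.mulVec y))
    (hρ : ∀ u, ‖fourierCoeff (fun y => remainder (toComplex f) L (M.mulVec y)) u‖ ≤ ρ)
    (hgran : ((p : ℝ) * s) ^ (p - 1) * ρ < 1) :
    ∃ g : Zpn p n → ℤˣ, IsSparse s g ∧ l2Dist (toComplex f) (toComplex g) ^ 2 ≤ 2 * (s * ρ) := by
  classical
  have hpn : ((p : ℂ) ^ n) ≠ 0 := pow_ne_zero _ (Nat.cast_ne_zero.2 (Fact.out : p.Prime).ne_zero)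
  set T : Finset (Zpn p n) := insert 0 ((L ×ˢ L).image fun a => a.1 + a.2) with hT
  have hTadd : ∀ a ∈ L, ∀ b ∈ L, a + b ∈ T := fun a ha b hb =>
    Finset.mem_insert_of_mem (Finset.mem_image.2 ⟨(a, b), Finset.mk_mem_product ha hb, rfl⟩)
  have hinjL : Set.InjOn (fun r => Matrix.vecMul r M) (L : Set (Zpn p n)) := by
    intro a ha b hb hab
    have h := hinj (hTadd a ha a ha) (hTadd a ha b hb)
      (by simp only [Matrix.add_vecMul]; rw [show Matrix.vecMul a M = Matrix.vecMul b M from hab])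
    exact add_left_cancel h
  let F : Zpn p k → ℤˣ := fun y => f (M.mulVec y)
  let c : Zpn p n → ℂ := fun r => fourierCoeff (toComplex F) (Matrix.vecMul r M)
  -- Folded coefficients are those of `f` on `L`, up to the contribution of the remainder.
  have hfold : ∀ u, fourierCoeff (toComplex F) u =
      (∑ r ∈ L, if Matrix.vecMul r M = u then fourierCoeff (toComplex f) r else 0) +
        fourierCoeff (fun y => remainder (toComplex f) L (M.mulVec y)) u := by
    intro u
    rw [show toComplex F = fun y => toComplex f (M.mulVec y) from rfl, fourierCoeff_comp_mulVec,
      fourierCoeff_comp_mulVec, ← Finset.sum_add_sum_compl L]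
    congr 1
    rw [← Finset.sum_add_sum_compl L (fun r => if Matrix.vecMul r M = u then
      fourierCoeff (remainder (toComplex f) L) r else 0)]
    rw [Finset.sum_eq_zero (s := L), zero_add]
    · refine Finset.sum_congr rfl fun r hr => ?_
      rw [fourierCoeff_remainder, if_neg (Finset.mem_compl.1 hr)]
    · intro r hr
      rw [fourierCoeff_remainder, if_pos hr, ite_self]
  have hclose : ∀ r ∈ L, ‖c r - fourierCoeff (toComplex f) r‖ ≤ ρ := by
    intro r hr
    refine le_of_eq_of_le ?_ (hρ (Matrix.vecMul r M))
    congr 1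
    rw [sub_eq_iff_eq_add', show c r = fourierCoeff (toComplex F) (Matrix.vecMul r M) from rfl,
      hfold]
    congr 1
    rw [Finset.sum_eq_single r (fun r' hr' hne => if_neg fun h => hne (hinjL hr' hr h))
      (fun h => absurd hr h), if_pos rfl]
  -- By granularity, the remainder alone cannot produce a coefficient.
  have hsupp : ∀ u, fourierCoeff (toComplex F) u ≠ 0 → ∃ r ∈ L, Matrix.vecMul r M = u := by
    intro u hu
    by_contra! hne
    have h1 := one_le_pow_mul_norm_fourierCoeff hs hu
    rw [hfold u, Finset.sum_eq_zero fun r hr => if_neg (hne r hr), zero_add] at h1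
    have h2 := mul_le_mul_of_nonneg_left (hρ u) (by positivity : 0 ≤ ((p : ℝ) * s) ^ (p - 1))
    linarith
  have hF : ∀ y, toComplex F y = ∑ r ∈ L, c r * character (Matrix.vecMul r M) y := by
    intro y
    rw [← sum_fourierCoeff_mul_character (toComplex F) y,
      ← Finset.sum_image (f := fun u => fourierCoeff (toComplex F) u * character u y) hinjL]
    refine (Finset.sum_subset (Finset.subset_univ _) fun u _ hu => ?_).symm
    rw [Finset.mem_image] at hu
    have : fourierCoeff (toComplex F) u = 0 := by
      by_contra h
      exact hu (hsupp u h)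
    rw [this, zero_mul]
  -- The equation `F² = 1`, read off in frequency space.
  have hconv : ∀ w, ∑ a ∈ L ×ˢ L, (if Matrix.vecMul (a.1 + a.2) M = w then c a.1 * c a.2 else 0) =
      if (0 : Zpn p k) = w then 1 else 0 := by
    intro w
    have h1 : (fun y => ∑ a ∈ L ×ˢ L, (c a.1 * c a.2) *
        character (Matrix.vecMul (a.1 + a.2) M) y) = character (0 : Zpn p k) := by
      funext y
      rw [character_zero_left, ← toComplex_mul_self F y, hF, Finset.sum_mul_sum,
        Finset.sum_product]
      refine Finset.sum_congr rfl fun a _ => Finset.sum_congr rfl fun b _ => ?_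
      rw [Matrix.add_vecMul, character_add_left]
      ring
    rw [← fourierCoeff_character, ← h1, fourierCoeff_sum_character]
  let G : Zpn p n → ℂ := fun x => ∑ r ∈ L, c r * character r x
  have hG : ∀ x, G x * G x = 1 := by
    intro x
    have h1 : G x * G x = ∑ a ∈ L ×ˢ L, (c a.1 * c a.2) * character (a.1 + a.2) x := by
      simp only [G, Finset.sum_mul_sum, Finset.sum_product, character_add_left]
      refine Finset.sum_congr rfl fun a _ => Finset.sum_congr rfl fun b _ => ?_
      ring
    -- group the pairs by their sum, which the linear map determines
    have h2 : ∀ z ∈ T, ∑ a ∈ L ×ˢ L with a.1 + a.2 = z, (c a.1 * c a.2) * character (a.1 + a.2) x =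
        if 0 = z then 1 else 0 := by
      intro z hz
      have h3 : ∑ a ∈ L ×ˢ L with a.1 + a.2 = z, c a.1 * c a.2 = if 0 = z then 1 else 0 := by
        have h4 := hconv (Matrix.vecMul z M)
        have h0 : (0 : Zpn p k) = Matrix.vecMul z M ↔ 0 = z := by
          constructor
          · intro h
            exact hinj (Finset.mem_insert_self _ _) hz (by simpa using h)
          · rintro rfl
            simp
        simp only [h0] at h4
        rw [← h4, Finset.sum_filter]
        refine Finset.sum_congr rfl fun a ha => ?_
        obtain ⟨ha1, ha2⟩ := Finset.mem_product.1 ha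
        have : a.1 + a.2 = z ↔ Matrix.vecMul (a.1 + a.2) M = Matrix.vecMul z M :=
          ⟨fun h => by rw [h], fun h => hinj (hTadd _ ha1 _ ha2) hz h⟩
        simp only [this]
      rw [Finset.sum_congr rfl fun a ha => by rw [(Finset.mem_filter.1 ha).2], ← Finset.sum_mul, h3]
      split_ifs with hz0
      · rw [← hz0, character_zero_left, mul_one]
      · rw [zero_mul]
    rw [h1, ← Finset.sum_fiberwise_of_maps_to (g := fun a => a.1 + a.2) (t := T) fun a ha =>
      hTadd _ (Finset.mem_product.1 ha).1 _ (Finset.mem_product.1 ha).2, Finset.sum_congr rfl h2,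
      Finset.sum_ite_eq, if_pos (Finset.mem_insert_self _ _)]
  have hex : ∀ x, ∃ ε : ℤˣ, ((ε : ℤ) : ℂ) = G x := by
    intro x
    rcases mul_self_eq_one_iff.1 (hG x) with h | h
    · exact ⟨1, by simp [h]⟩
    · exact ⟨-1, by simp [h]⟩
  choose g hg using hex
  have hgG : toComplex g = G := funext hg
  have hcoef : ∀ r, fourierCoeff G r = if r ∈ L then c r else 0 := by
    intro r
    have h := fourierCoeff_sum_character L c (fun r => r) r
    rw [show G = fun x => ∑ r ∈ L, c r * character r x from rfl, h, Finset.sum_ite_eq' L r]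
  refine ⟨g, ?_, ?_⟩
  · refine le_trans ?_ hs
    refine Set.ncard_le_ncard_of_injOn (fun r => Matrix.vecMul r M) ?_ ?_ (Set.toFinite _)
    · intro r hr
      have hr' : fourierCoeff (toComplex g) r ≠ 0 := hr
      rw [hgG, hcoef] at hr'
      by_cases h : r ∈ L
      · rwa [if_pos h] at hr'
      · exact absurd (if_neg h) hr'
    · refine hinjL.mono fun r hr => ?_
      have hr' : fourierCoeff (toComplex g) r ≠ 0 := hr
      rw [hgG, hcoef] at hr'
      by_contra h
      exact hr' (if_neg h)
  · have hcard : (L.filter fun r => c r ≠ 0).card ≤ s := by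
      refine le_trans ?_ hs
      rw [← Set.ncard_coe_finset]
      refine Set.ncard_le_ncard_of_injOn (fun r => Matrix.vecMul r M) ?_ ?_ (Set.toFinite _)
      · intro r hr
        exact (Finset.mem_filter.1 hr).2
      · exact hinjL.mono fun r hr => (Finset.mem_filter.1 hr).1
    have hfg := sum_mul_conj_sum_character (toComplex f) L c
    have hgg := sum_mul_conj_sum_character (toComplex g) L c
    have hconjG : ∀ x, conj (∑ r ∈ L, c r * character r x) = toComplex g x := fun x => by
      rw [show ∑ r ∈ L, c r * character r x = toComplex g x from (hg x).symm, conj_toComplex]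
    simp only [hconjG] at hfg hgg
    have hone : (∑ x, toComplex g x * toComplex g x) / (p : ℂ) ^ n = 1 := by
      simp [toComplex_mul_self, hpn]
    have hdiff : ‖1 - (∑ x, toComplex f x * toComplex g x) / (p : ℂ) ^ n‖ ≤ s * ρ := by
      rw [← hone, hfg, hgg, ← Finset.sum_sub_distrib]
      calc _ ≤ ∑ r ∈ L, if c r ≠ 0 then ρ else 0 := by
            refine (norm_sum_le _ _).trans (Finset.sum_le_sum fun r hr => ?_)
            rw [hgG, hcoef, if_pos hr, ← mul_sub, norm_mul, RCLike.norm_conj]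
            split_ifs with h0
            · calc _ ≤ 1 * ρ := mul_le_mul (norm_fourierCoeff_toComplex_le_one F _) (hclose r hr)
                    (norm_nonneg _) zero_le_one
                _ = ρ := one_mul ρ
            · rw [not_not.1 h0, norm_zero, zero_mul]
        _ = (L.filter fun r => c r ≠ 0).card * ρ := by
            rw [← Finset.sum_filter, Finset.sum_const, nsmul_eq_mul]
        _ ≤ s * ρ := by
            have : 0 ≤ ρ := (norm_nonneg _).trans (hρ 0)
            gcongr
    have hexp : ((l2Dist (toComplex f) (toComplex g) ^ 2 : ℝ) : ℂ) =
        2 * (1 - (∑ x, toComplex f x * toComplex g x) / (p : ℂ) ^ n) := by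
      rw [l2Dist, Real.sq_sqrt (by positivity)]
      have hpt : ∀ x, ((‖toComplex f x - toComplex g x‖ : ℂ)) ^ 2 =
          2 - 2 * (toComplex f x * toComplex g x) := by
        intro x
        rw [← Complex.mul_conj', map_sub, conj_toComplex, conj_toComplex]
        linear_combination toComplex_mul_self f x + toComplex_mul_self g x
      push_cast
      simp only [hpt, Finset.sum_sub_distrib, ← Finset.mul_sum]
      simp only [Finset.sum_const, Finset.card_univ, card_Zpn, nsmul_eq_mul, Nat.cast_pow]
      field_simp
    have hsq : 0 ≤ l2Dist (toComplex f) (toComplex g) ^ 2 := sq_nonneg _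
    rw [← Real.norm_of_nonneg hsq, ← Complex.norm_real, hexp, norm_mul]
    calc _ = 2 * ‖1 - (∑ x, toComplex f x * toComplex g x) / (p : ℂ) ^ n‖ := by simp
      _ ≤ _ := by gcongr

/-! ### The tester -/

theorem card_exists_lt_norm_fourierCoeff_le (h : Zpn p n → ℂ) {ρ B : ℝ} (hρ : 0 < ρ)
    (hB : ∀ x, ‖h x‖ ≤ B) :
    ((Finset.univ.filter fun M : Matrix (Fin n) (Fin k) (ZMod p) =>
      ∃ u, ρ < ‖fourierCoeff (fun y => h (M.mulVec y)) u‖).card : ℝ) * ρ ^ 4 ≤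
      Fintype.card (Matrix (Fin n) (Fin k) (ZMod p)) *
        (∑ r, ‖fourierCoeff h r‖ ^ 4 + B ^ 4 * (3 * (p : ℝ) ^ 2 / (p : ℝ) ^ k)) := by
  refine le_trans ?_ (sum_sum_norm_pow_four_fourierCoeff_comp_le h hB)
  rw [← nsmul_eq_mul]
  refine (Finset.card_nsmul_le_sum _ (fun M : Matrix (Fin n) (Fin k) (ZMod p) =>
    ∑ u, ‖fourierCoeff (fun y => h (M.mulVec y)) u‖ ^ 4) _ fun M hM => ?_).trans
      (Finset.sum_le_sum_of_subset_of_nonneg (Finset.subset_univ _) fun M _ _ => by positivity)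
  obtain ⟨u, hu⟩ := (Finset.mem_filter.1 hM).2
  refine le_trans ?_ (Finset.single_le_sum
    (f := fun u => ‖fourierCoeff (fun y => h (M.mulVec y)) u‖ ^ 4)
    (fun _ _ => by positivity) (Finset.mem_univ u))
  exact pow_le_pow_left₀ hρ.le hu.le 4

/-- The restriction of a function which is far from `s`-sparse-Boolean along a random linear map
from a space of polynomial size is `s`-sparse with probability at most `1/3`. Here `1 / D` bounds
the admissible noise in a folded coefficient, and `1 / m` is the threshold for `|f̂|²` above which a
frequency counts as large; the constants make each of the two bad events have probability at most
`1/6`. -/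
theorem three_mul_card_isSparse_comp_le {s : ℕ} {ε D m : ℝ} (hε : 0 < ε) (hD : 1 ≤ D)
    (hDgran : ((p : ℝ) * s) ^ (p - 1) < D) (hDε : 2 * s < ε * D) (hm : m = 12 * D ^ 4)
    (hk : 36 * (p : ℝ) ^ 2 * (1 + m) ^ 4 * D ^ 4 ≤ (p : ℝ) ^ k) (f : Zpn p n → ℤˣ)
    (hf : IsFarFromSparse s ε f) :
    3 * Nat.card {M : Matrix (Fin n) (Fin k) (ZMod p) // IsSparse s fun y => f (M.mulVec y)} ≤
      Nat.card (Matrix (Fin n) (Fin k) (ZMod p)) := by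
  classical
  have hp1 : (1 : ℝ) ≤ p := by exact_mod_cast (Fact.out : p.Prime).one_le
  have hD4 : 1 ≤ D ^ 4 := one_le_pow₀ hD
  have hm0 : 0 < m := by rw [hm]; positivity
  have hpk : (0 : ℝ) < (p : ℝ) ^ k := by positivity
  -- the frequencies with large coefficients
  let L : Finset (Zpn p n) := Finset.univ.filter fun r => 1 ≤ m * ‖fourierCoeff (toComplex f) r‖ ^ 2
  have hLcard : (L.card : ℝ) ≤ m := by
    have h1 : L.card • (1 : ℝ) ≤ ∑ r ∈ L, m * ‖fourierCoeff (toComplex f) r‖ ^ 2 :=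
      Finset.card_nsmul_le_sum _ _ _ fun r hr => (Finset.mem_filter.1 hr).2
    have h2 := Finset.sum_le_sum_of_subset_of_nonneg (Finset.subset_univ L)
      (f := fun r => m * ‖fourierCoeff (toComplex f) r‖ ^ 2) fun r _ _ => by positivity
    rw [← Finset.mul_sum, ← Finset.mul_sum, sum_norm_sq_fourierCoeff_toComplex] at h2
    rw [← Finset.mul_sum] at h1
    simp only [nsmul_eq_mul, mul_one] at h1 h2
    exact h1.trans h2
  have hrem : ∑ r, ‖fourierCoeff (remainder (toComplex f) L) r‖ ^ 4 ≤ 1 / m := by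
    rw [← sum_norm_sq_fourierCoeff_toComplex f, Finset.sum_div]
    refine Finset.sum_le_sum fun r _ => ?_
    rw [fourierCoeff_remainder]
    split_ifs with h
    · rw [norm_zero, zero_pow four_ne_zero]
      positivity
    · have h1 : m * ‖fourierCoeff (toComplex f) r‖ ^ 2 < 1 := by simpa [L] using h
      rw [le_div_iff₀ hm0]
      nlinarith [sq_nonneg ‖fourierCoeff (toComplex f) r‖]
  set T : Finset (Zpn p n) := insert 0 ((L ×ˢ L).image fun a => a.1 + a.2) with hT
  have hTcard : (T.card : ℝ) ≤ (1 + m) ^ 2 := by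
    have h1 : T.card ≤ L.card * L.card + 1 := by
      refine (Finset.card_insert_le _ _).trans (Nat.succ_le_succ ?_)
      exact Finset.card_image_le.trans (Finset.card_product _ _).le
    have h2 : (T.card : ℝ) ≤ L.card * L.card + 1 := by exact_mod_cast h1
    nlinarith [(Nat.cast_nonneg L.card : (0 : ℝ) ≤ L.card)]
  let bad₁ := Finset.univ.filter fun M : Matrix (Fin n) (Fin k) (ZMod p) =>
      ∃ u, 1 / D < ‖fourierCoeff (fun y => remainder (toComplex f) L (M.mulVec y)) u‖
  let bad₂ := Finset.univ.filter fun M : Matrix (Fin n) (Fin k) (ZMod p) =>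
      ¬ Set.InjOn (fun r => Matrix.vecMul r M) (T : Set (Zpn p n))
  obtain ⟨N, hN⟩ : ∃ N : ℝ, N = (Fintype.card (Matrix (Fin n) (Fin k) (ZMod p)) : ℕ) := ⟨_, rfl⟩
  have hN0 : 0 ≤ N := hN ▸ Nat.cast_nonneg _
  have hbad₁ : 6 * (bad₁.card : ℝ) ≤ N := by
    have h1 := card_exists_lt_norm_fourierCoeff_le (k := k) (remainder (toComplex f) L)
      (ρ := 1 / D) (by positivity) (norm_remainder_le f L)
    rw [← hN] at h1
    have h2 : (1 + (L.card : ℝ)) ^ 4 * (3 * (p : ℝ) ^ 2 / (p : ℝ) ^ k) ≤ 1 / (12 * D ^ 4) := by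
      rw [← mul_div_assoc, div_le_div_iff₀ hpk (by positivity)]
      calc _ ≤ (1 + m) ^ 4 * (3 * (p : ℝ) ^ 2) * (12 * D ^ 4) := by gcongr
        _ = 36 * (p : ℝ) ^ 2 * (1 + m) ^ 4 * D ^ 4 := by ring
        _ ≤ _ := by rw [one_mul]; exact hk
    have h3 : (bad₁.card : ℝ) * (1 / D) ^ 4 ≤ N * (1 / (12 * D ^ 4) + 1 / (12 * D ^ 4)) :=
      h1.trans (mul_le_mul_of_nonneg_left (add_le_add (hm ▸ hrem) h2) hN0)
    have h4 : (bad₁.card : ℝ) * (1 / D) ^ 4 * (6 * D ^ 4) ≤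
        N * (1 / (12 * D ^ 4) + 1 / (12 * D ^ 4)) * (6 * D ^ 4) := by gcongr
    have h5 : (bad₁.card : ℝ) * (1 / D) ^ 4 * (6 * D ^ 4) = 6 * bad₁.card := by field_simp
    have h6 : N * (1 / (12 * D ^ 4) + 1 / (12 * D ^ 4)) * (6 * D ^ 4) = N := by field_simp; ring
    linarith
  have hbad₂ : 6 * (bad₂.card : ℝ) ≤ N := by
    have h1 : (p : ℝ) ^ k * bad₂.card ≤ (T.card : ℝ) ^ 2 * N := by
      rw [hN]
      exact_mod_cast pow_mul_card_not_injOn_vecMul_le (k := k) T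
    have h2 : (T.card : ℝ) ^ 2 ≤ (1 + m) ^ 4 := by
      calc _ ≤ ((1 + m) ^ 2) ^ 2 := by gcongr
        _ = _ := by ring
    have h3 : 6 * (1 + m) ^ 4 ≤ (p : ℝ) ^ k := by
      refine le_trans ?_ hk
      have h4 : 1 ≤ (p : ℝ) ^ 2 * D ^ 4 := one_le_mul_of_one_le_of_one_le (one_le_pow₀ hp1) hD4
      have h5 : 0 ≤ (1 + m) ^ 4 := by positivity
      nlinarith [mul_le_mul_of_nonneg_left h4 h5]
    have h4 : (p : ℝ) ^ k * (6 * bad₂.card) ≤ (p : ℝ) ^ k * N := by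
      calc _ = 6 * ((p : ℝ) ^ k * bad₂.card) := by ring
        _ ≤ 6 * ((1 + m) ^ 4 * N) :=
          mul_le_mul_of_nonneg_left (h1.trans (mul_le_mul_of_nonneg_right h2 hN0)) (by norm_num)
        _ = (6 * (1 + m) ^ 4) * N := by ring
        _ ≤ _ := by gcongr
    exact le_of_mul_le_mul_left h4 hpk
  have hsub : (Finset.univ.filter fun M : Matrix (Fin n) (Fin k) (ZMod p) =>
      IsSparse s fun y => f (M.mulVec y)) ⊆ bad₁ ∪ bad₂ := by
    intro M hM
    by_contra hgood
    simp only [bad₁, bad₂, Finset.mem_union, Finset.mem_filter, Finset.mem_univ, true_and, not_or,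
      not_exists, not_lt, not_not] at hgood
    obtain ⟨g, hg, hfg⟩ := exists_isSparse_close f L M hgood.2 (Finset.mem_filter.1 hM).2 hgood.1
      (by rw [mul_one_div, div_lt_one (by linarith)]; exact hDgran)
    have h1 : ε ≤ l2Dist (toComplex f) (toComplex g) ^ 2 := by
      rw [← Real.sq_sqrt hε.le]
      exact pow_le_pow_left₀ (Real.sqrt_nonneg _) (hf g hg) 2
    have h2 : 2 * (s * (1 / D)) < ε := by
      rw [show 2 * (s * (1 / D)) = 2 * s / D by ring, div_lt_iff₀ (by linarith)]
      exact hDε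
    linarith
  have hcard := (Finset.card_le_card hsub).trans (Finset.card_union_le _ _)
  rw [Nat.card_eq_fintype_card, Nat.card_eq_fintype_card, Fintype.card_subtype]
  have hcard' : ((Finset.univ.filter fun M : Matrix (Fin n) (Fin k) (ZMod p) =>
      IsSparse s fun y => f (M.mulVec y)).card : ℝ) ≤ bad₁.card + bad₂.card := by
    exact_mod_cast hcard
  have hfin : (3 * (Finset.univ.filter fun M : Matrix (Fin n) (Fin k) (ZMod p) =>
      IsSparse s fun y => f (M.mulVec y)).card : ℝ) ≤ N := by linarith
  rw [hN] at hfin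
  exact_mod_cast hfin

open Classical in
/-- The tester: query the function on the image of a random linear map from `ℤ_p^k`, and accept
if and only if the restriction is `s`-sparse. -/
noncomputable def restrictionTester (p n k s : ℕ) [Fact p.Prime] :
    NonadaptiveTester (Zpn p n) (p ^ k) where
  Seed := Matrix (Fin n) (Fin k) (ZMod p)
  law := PMF.uniformOfFintype _
  query M i := M.mulVec ((Fintype.equivFinOfCardEq card_Zpn).symm i)
  verdict _ a := decide (IsSparse s fun y : Zpn p k => a (Fintype.equivFinOfCardEq card_Zpn y))

theorem run_restrictionTester {s : ℕ} (f : Zpn p n → ℤˣ) (M : Matrix (Fin n) (Fin k) (ZMod p)) :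
    (restrictionTester p n k s).run f M = true ↔ IsSparse s fun y => f (M.mulVec y) := by
  simp [NonadaptiveTester.run, restrictionTester]

theorem probOutput_restrictionTester {s : ℕ} (f : Zpn p n → ℤˣ) (b : Bool) :
    (restrictionTester p n k s).probOutput f b =
      Nat.card {M : Matrix (Fin n) (Fin k) (ZMod p) // (restrictionTester p n k s).run f M = b} /
        Nat.card (Matrix (Fin n) (Fin k) (ZMod p)) := by
  classical
  have h := PMF.toOuterMeasure_uniformOfFintype_apply (α := Matrix (Fin n) (Fin k) (ZMod p))
    {M | (restrictionTester p n k s).run f M = b}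
  rw [← Nat.card_eq_fintype_card, ← Nat.card_eq_fintype_card] at h
  exact h

theorem testsSparsity_restrictionTester {s : ℕ} {ε : ℝ}
    (h : ∀ f : Zpn p n → ℤˣ, IsFarFromSparse s ε f →
      3 * Nat.card {M : Matrix (Fin n) (Fin k) (ZMod p) // IsSparse s fun y => f (M.mulVec y)} ≤
        Nat.card (Matrix (Fin n) (Fin k) (ZMod p))) :
    TestsSparsity s ε (restrictionTester p n k s) := by
  classical
  intro f
  have hN : (Nat.card (Matrix (Fin n) (Fin k) (ZMod p)) : ℝ≥0∞) ≠ 0 := by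
    simp
  have hreduce : ∀ b, 2 * Nat.card (Matrix (Fin n) (Fin k) (ZMod p)) ≤ 3 * Nat.card
      {M : Matrix (Fin n) (Fin k) (ZMod p) // (restrictionTester p n k s).run f M = b} →
        2 / 3 ≤ (restrictionTester p n k s).probOutput f b := by
    intro b hb
    rw [probOutput_restrictionTester, ENNReal.le_div_iff_mul_le (Or.inl hN)
      (Or.inl (ENNReal.natCast_ne_top _)), ENNReal.mul_comm_div, ← mul_div_assoc, mul_comm]
    refine ENNReal.div_le_of_le_mul ?_
    rw [mul_comm, mul_comm _ (3 : ℝ≥0∞)]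
    exact_mod_cast hb
  constructor
  · intro hf
    refine hreduce true ?_
    have : Nat.card {M : Matrix (Fin n) (Fin k) (ZMod p) //
        (restrictionTester p n k s).run f M = true} =
          Nat.card (Matrix (Fin n) (Fin k) (ZMod p)) :=
      Nat.card_congr (Equiv.subtypeUnivEquiv fun M =>
        (run_restrictionTester f M).2 (hf.comp_mulVec M))
    omega
  · intro hf
    refine hreduce false ?_
    have h1 := h f hf
    have h2 : Nat.card {M : Matrix (Fin n) (Fin k) (ZMod p) //
        IsSparse s fun y => f (M.mulVec y)} + Nat.card {M : Matrix (Fin n) (Fin k) (ZMod p) //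
          (restrictionTester p n k s).run f M = false} =
            Nat.card (Matrix (Fin n) (Fin k) (ZMod p)) := by
      have h3 : ∀ M : Matrix (Fin n) (Fin k) (ZMod p), (restrictionTester p n k s).run f M = false ↔
          ¬ IsSparse s fun y => f (M.mulVec y) := fun M => by
        rw [← run_restrictionTester, Bool.not_eq_true]
      rw [Nat.card_congr (Equiv.subtypeEquivRight h3), ← Nat.card_sum]
      exact Nat.card_congr (Equiv.sumCompl _)
    omega

end SparsityTest

theorem mainTheorem5 :
    ∃ P : MvPolynomial (Fin 2) ℝ,
      ∀ (p : ℕ) [Fact p.Prime] (s : ℕ) (ε : ℝ), 0 < ε →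
        ∃ q : ℕ,
          (q : ℝ) ≤ MvPolynomial.eval ![((p : ℝ) ^ 2 * (s : ℝ)) ^ p, 1 / ε] P ∧
          ∀ n : ℕ, ∃ T : NonadaptiveTester (SparsityTest.Zpn p n) q,
            SparsityTest.TestsSparsity s ε T := by
  -- `D` dominates both the inverse granularity and `2 s / ε`
  let D : MvPolynomial (Fin 2) ℝ :=
    1 + MvPolynomial.X 0 + 2 * MvPolynomial.X 0 * MvPolynomial.X 1
  refine ⟨36 * MvPolynomial.X 0 ^ 3 * (1 + 12 * D ^ 4) ^ 4 * D ^ 4, ?_⟩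
  intro p _ s ε hε
  have hp : p.Prime := Fact.out
  simp only [D, map_mul, map_pow, map_add, map_one, MvPolynomial.eval_X, map_ofNat,
    Matrix.cons_val_zero, Matrix.cons_val_one]
  set X : ℝ := ((p : ℝ) ^ 2 * s) ^ p with hX
  have hX0 : 0 ≤ X := by positivity
  rcases Nat.eq_zero_or_pos s with rfl | hs
  · -- no function is `0`-sparse, so rejecting without a query is correct
    refine ⟨0, by simpa using by positivity, fun n => ⟨⟨Unit, PMF.pure (), fun _ i => i.elim0,
      fun _ _ => false⟩, fun f => ⟨fun h => absurd h (SparsityTest.not_isSparse_zero f),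
        fun _ => ?_⟩⟩⟩
    have h1 : (PMF.pure ()).toOuterMeasure (Set.univ : Set Unit) = 1 := by simp
    have h2 : (2 / 3 : ℝ≥0∞) ≤ 1 := ENNReal.div_le_of_le_mul (by norm_num)
    simpa [NonadaptiveTester.probOutput, NonadaptiveTester.run] using h2
  · have hp1 : (1 : ℝ) ≤ p := by exact_mod_cast hp.one_le
    have hs1 : (1 : ℝ) ≤ s := by exact_mod_cast hs
    have hps : (1 : ℝ) ≤ p * s := one_le_mul_of_one_le_of_one_le hp1 hs1
    have hle : (p : ℝ) * s ≤ (p : ℝ) ^ 2 * s := by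
      gcongr
      exact le_self_pow₀ hp1 two_ne_zero
    have hXbase : (p : ℝ) ^ 2 * s ≤ X := le_self_pow₀ (hps.trans hle) hp.ne_zero
    have hXp : (p : ℝ) ≤ X := (le_mul_of_one_le_right (by positivity) hs1).trans (hle.trans hXbase)
    have hXs : (s : ℝ) ≤ X := (le_mul_of_one_le_left (by positivity) hp1).trans (hle.trans hXbase)
    have hXgran : ((p : ℝ) * s) ^ (p - 1) ≤ X :=
      (pow_le_pow_right₀ hps (Nat.sub_le p 1)).trans (pow_le_pow_left₀ (by positivity) hle p)
    set d : ℝ := 1 + X + 2 * X * (1 / ε) with hd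
    have hY : 0 ≤ 2 * X * (1 / ε) := by positivity
    have hd1 : 1 ≤ d := by linarith
    have hdgran : ((p : ℝ) * s) ^ (p - 1) < d := by linarith
    have hdε : 2 * s < ε * d := by
      have : ε * d = ε * (1 + X) + 2 * X := by
        rw [hd]
        field_simp
      have : 0 < ε * (1 + X) := by positivity
      linarith
    -- the least power of `p` above the number of points required by the analysis
    set Q : ℝ := 36 * (p : ℝ) ^ 2 * (1 + 12 * d ^ 4) ^ 4 * d ^ 4 with hQ
    have hQ1 : 1 ≤ Q := by
      have h1 : 1 ≤ d ^ 4 := one_le_pow₀ hd1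
      have h2 : 1 ≤ (1 + 12 * d ^ 4) ^ 4 := one_le_pow₀ (by linarith)
      have h3 : 1 ≤ (p : ℝ) ^ 2 := one_le_pow₀ hp1
      rw [hQ]
      refine one_le_mul_of_one_le_of_one_le (one_le_mul_of_one_le_of_one_le ?_ h2) h1
      linarith
    have hfl : ⌊Q⌋₊ ≠ 0 := (Nat.floor_pos.2 hQ1).ne'
    let k := Nat.log p ⌊Q⌋₊ + 1
    have hk : Q ≤ (p : ℝ) ^ k := by
      have h1 : ⌊Q⌋₊ < p ^ k := Nat.lt_pow_succ_log_self hp.one_lt _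
      exact_mod_cast ((Nat.floor_lt (by linarith)).1 h1).le
    have hk' : (p : ℝ) ^ k ≤ p * Q := by
      have h1 : p ^ Nat.log p ⌊Q⌋₊ ≤ ⌊Q⌋₊ := Nat.pow_log_le_self p hfl
      have h2 : (p : ℝ) ^ Nat.log p ⌊Q⌋₊ ≤ Q :=
        le_trans (by exact_mod_cast h1) (Nat.floor_le (by linarith))
      rw [pow_succ, mul_comm]
      gcongr
    refine ⟨p ^ k, ?_, fun n => ⟨SparsityTest.restrictionTester p n k s,
      SparsityTest.testsSparsity_restrictionTester fun f hf =>
        SparsityTest.three_mul_card_isSparse_comp_le hε hd1 hdgran hdε rfl hk f hf⟩⟩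
    push_cast
    calc (p : ℝ) ^ k ≤ p * Q := hk'
      _ = 36 * (p : ℝ) ^ 3 * (1 + 12 * d ^ 4) ^ 4 * d ^ 4 := by rw [hQ]; ring
      _ ≤ _ := by gcongr
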